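/- **Setting.** Fix an integer $L\ge 2$ and reals $0<\lambda<1$, $\sigma^2>0$, $P_{\mathsf p}>0$, $P_{\max}>0$, $\theta_{\mathsf p}>0$, $\theta_{\mathsf s}>0$; put $\gamma_{\mathsf p}=P_{\mathsf p}/\sigma^2$ and $\gamma_{\max}=P_{\max}/\sigma^2$. A primary link with a single-antenna transmitter and receiver has the random channel $h_{\mathsf p}\sim\mathcal{CN}(0,1)$ and channel power $g_{\mathsf p}=|h_{\mathsf p}|^2$. A secondary transmitter (SU) with $L$ antennas has the channel $\mathbf h_{\mathsf s}\in\mathbb C^L$ to its own receiver, with i.i.d. $\mathcal{CN}(0,1)$ entries, and the channel $\mathbf h_{\mathsf x}\in\mathbb C^L$ to the primary receiver, with i.i.d. $\mathcal{CN}(0,\lambda)$ entries. The three channels are independent. Write $g_{\mathsf s}=\|\mathbf h_{\mathsf s}\|^2$, $\mathbf s_{\mathsf s}=\mathbf h_{\mathsf s}/\|\mathbf h_{\mathsf s}\|$, $g_{\mathsf x}=\|\mathbf h_{\mathsf x}\|^2/\lambda$, $\mathbf s_{\mathsf x}=\mathbf h_{\mathsf x}/\|\mathbf h_{\mathsf x}\|$.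 *Quantized CDI ($B$ bits).* The direction $\mathbf s_{\mathsf x}$ is quantized to a random unit vector $\hat{\mathbf s}_{\mathsf x}$. The quantizer acts on $\mathbf s_{\mathsf x}$ only: $(\mathbf s_{\mathsf x},\hat{\mathbf s}_{\mathsf x})$ is independent of $g_{\mathsf x}$, and $(\mathbf h_{\mathsf x},\hat{\mathbf s}_{\mathsf x})$, $h_{\mathsf p}$, $\mathbf h_{\mathsf s}$ are mutually independent. Its error $\epsilon=1-|\hat{\mathbf s}_{\mathsf x}^\dagger\mathbf s_{\mathsf x}|^2$ satisfies $\Pr(\epsilon\le\tau)=2^B\tau^{L-1}$ for $0\le\tau\le 2^{-B/(L-1)}$ and $\Pr(\epsilon\le\tau)=1$ for $\tau>2^{-B/(L-1)}$. *Quantized interference-power control (IPC, $A$ bits), without feedforward.* Let $\omega=\sigma^2(\gamma_{\mathsf p}g_{\mathsf p}/\theta_{\mathsf p}-1)$, and let $\eta=\omega/(\lambda g_{\mathsf x}\epsilon)$ if $\omega\ge 0$, $\eta=P_{\max}$ otherwise. With $N=2^A$, the codebook $\mathcal P=\{p_0<p_1<\dots<p_{N-1}\}$ is the equal-probability one: $p_0=0$,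 $\Pr(p_n<\eta\le p_{n+1}\mid\gamma_{\mathsf p}g_{\mathsf p}\ge\theta_{\mathsf p})=1/N$ for $0\le n\le N-2$, and $\Pr(\eta>p_{N-1}\mid\gamma_{\mathsf p}g_{\mathsf p}\ge\theta_{\mathsf p})=1/N$. The quantized IPC signal is $\hat\eta=\max\{p\in\mathcal P:p\le\eta\}$ if $\omega\ge 0$ and $\eta<P_{\max}$, and $\hat\eta=P_{\max}$ otherwise. *Orthogonal cognitive beamforming (OCB).* The beamformer $\mathbf f_{\mathsf o}\in\mathbb C^L$ maximizes $|\mathbf f^\dagger\mathbf s_{\mathsf s}|^2$ subject to $\mathbf f^\dagger\hat{\mathbf s}_{\mathsf x}=0$ and $\|\mathbf f\|^2\le\hat\eta$. The SU receive SNR is $\mathsf{SNR}_{\mathsf s}=\frac{g_{\mathsf s}}{\sigma^2}|\mathbf f_{\mathsf o}^\dagger\mathbf s_{\mathsf s}|^2$, and the SU outage probability is $\hat P_{\mathsf{out}}=\Pr(\mathsf{SNR}_{\mathsf s}\le\theta_{\mathsf s})$. **Proposition.** Let $\Gamma(s,x)=\int_x^\infty t^{s-1}e^{-t}\,dt$,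 $$\varphi=e^{-\theta_{\mathsf p}/\gamma_{\mathsf p}}\,\frac{(L-1)\lambda\theta_{\mathsf p}\theta_{\mathsf s}\,\Gamma(L-2,\theta_{\mathsf s}/\gamma_{\max})}{\gamma_{\mathsf p}\,\Gamma(L-1)},\qquad \alpha=e^{-\theta_{\mathsf p}/\gamma_{\mathsf p}}\,\frac{\Gamma(L-1,\theta_{\mathsf s}/\gamma_{\max})}{\Gamma(L-1)}.$$ There is a constant $C$ depending only on $L,\lambda,\sigma^2,P_{\mathsf p},P_{\max},\theta_{\mathsf p},\theta_{\mathsf s}$ (not on $A$ and $B$) such that for all integers $A,B\ge 0$ $$\hat P_{\mathsf{out}}\le 1-\frac{\Gamma(L-1,\theta_{\mathsf s}/\gamma_{\max})}{\Gamma(L-1)}+\varphi\,2^{-B/(L-1)}+\alpha\,2^{-A}+C\,2^{-2B/(L-1)}.$$ -/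

import Mathlib

open MeasureTheory ProbabilityTheory

universe u

noncomputable section

/-- The upper incomplete gamma function `Γ(s, x) = ∫_x^∞ t^(s-1) e^(-t) dt` (used for `x > 0`). -/
def upperGamma (s x : ℝ) : ℝ := ∫ t in Set.Ioi x, t ^ (s - 1) * Real.exp (-t)

/-- The circularly symmetric complex Gaussian law `CN(0, v)`: the real and imaginary parts are
independent centred real Gaussians of variance `v / 2`. -/
def complexNormal (v : NNReal) : Measure ℂ :=
  ((gaussianReal 0 (v / 2)).prod (gaussianReal 0 (v / 2))).map Complex.measurableEquivRealProd.symm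

/-- The shape `h / ‖h‖` of a channel vector. -/
def channelShape {L : ℕ} (h : EuclideanSpace ℂ (Fin L)) : EuclideanSpace ℂ (Fin L) :=
  ((‖h‖⁻¹ : ℝ) : ℂ) • h

/-- Deterministic parameters of the network. -/
structure SystemParams where
  /-- number of antennas of the secondary transmitter -/
  L : ℕ
  /-- relative path loss of the cross link -/
  lam : ℝ
  /-- noise variance `σ²` -/
  noise : ℝ
  /-- primary transmission power -/
  Pp : ℝ
  /-- maximum secondary transmission power -/
  Pmax : ℝ
  /-- primary SINR threshold -/
  thetaP : ℝ
  /-- secondary SNR threshold -/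
  thetaS : ℝ
  two_le_L : 2 ≤ L
  lam_pos : 0 < lam
  lam_lt_one : lam < 1
  noise_pos : 0 < noise
  Pp_pos : 0 < Pp
  Pmax_pos : 0 < Pmax
  thetaP_pos : 0 < thetaP
  thetaS_pos : 0 < thetaS

namespace SystemParams

variable (S : SystemParams)

/-- Primary transmit SNR `γ_p = P_p / σ²`. -/
def gammaP : ℝ := S.Pp / S.noise

/-- Maximum secondary transmit SNR `γ_max = P_max / σ²`. -/
def gammaMax : ℝ := S.Pmax / S.noise

/-- The coefficient `φ` of the CDI quantization term. -/
def phi : ℝ :=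
  Real.exp (-(S.thetaP / S.gammaP)) *
    ((((S.L : ℝ) - 1) * S.lam * S.thetaP * S.thetaS *
        upperGamma ((S.L : ℝ) - 2) (S.thetaS / S.gammaMax)) /
      (S.gammaP * Real.Gamma ((S.L : ℝ) - 1)))

/-- The coefficient `α` of the IPC quantization term. -/
def alpha : ℝ :=
  Real.exp (-(S.thetaP / S.gammaP)) *
    (upperGamma ((S.L : ℝ) - 1) (S.thetaS / S.gammaMax) / Real.Gamma ((S.L : ℝ) - 1))

end SystemParams

/-- The random channels, together with the CDI quantized to `B` bits.
The fields `indep_*` say that the three channels are independent, that the CDI quantizer acts on the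
shape of the cross channel only (so it sees neither the other channels nor the gain of the cross
channel). The fields `cdf_*` are the sphere-cap model of a `B`-bit quantizer. -/
structure ChannelModel (S : SystemParams) (B : ℕ) {Ω : Type*} [MeasurableSpace Ω]
    (μ : Measure Ω) where
  /-- primary link -/
  hp : Ω → ℂ
  /-- cross link, from the secondary transmitter to the primary receiver -/
  hx : Ω → EuclideanSpace ℂ (Fin S.L)
  /-- secondary link -/
  hs : Ω → EuclideanSpace ℂ (Fin S.L)
  /-- quantized shape of the cross link -/
  sHat : Ω → EuclideanSpace ℂ (Fin S.L)
  measurable_hp : Measurable hp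
  measurable_hx : Measurable hx
  measurable_hs : Measurable hs
  measurable_sHat : Measurable sHat
  law_hp : μ.map hp = complexNormal 1
  /-- the entries of `hx` are i.i.d. `CN(0, λ)` -/
  law_hx : μ.map (fun w i => hx w i) = Measure.pi fun _ => complexNormal S.lam.toNNReal
  /-- the entries of `hs` are i.i.d. `CN(0, 1)` -/
  law_hs : μ.map (fun w i => hs w i) = Measure.pi fun _ => complexNormal 1
  norm_sHat : ∀ w, ‖sHat w‖ = 1
  indep_primary : IndepFun hp (fun w => (hx w, sHat w)) μ
  indep_secondary : IndepFun (fun w => (hp w, hx w, sHat w)) hs μ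
  indep_gain : IndepFun (fun w => ‖hx w‖) (fun w => (channelShape (hx w), sHat w)) μ
  cdf_le : ∀ τ : ℝ, 0 ≤ τ → τ ≤ (2 : ℝ) ^ (-(B : ℝ) / ((S.L : ℝ) - 1)) →
    μ.real {w | 1 - ‖inner ℂ (sHat w) (channelShape (hx w))‖ ^ 2 ≤ τ} = 2 ^ B * τ ^ (S.L - 1)
  cdf_gt : ∀ τ : ℝ, (2 : ℝ) ^ (-(B : ℝ) / ((S.L : ℝ) - 1)) < τ →
    μ.real {w | 1 - ‖inner ℂ (sHat w) (channelShape (hx w))‖ ^ 2 ≤ τ} = 1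

/-- `⌊x⌋_P`, the largest element `≤ x` of the codebook `P = {p 0, p 1, …}`, for `x ≥ 0 = p 0`. -/
def codebookFloor {N : ℕ} (p : Fin N → ℝ) (x : ℝ) : ℝ := sSup {q | q ∈ Set.range p ∧ q ≤ x}

/-- `f` solves the orthogonal cognitive beamforming problem: maximize `|f† s|²` subject to
`f† ŝ = 0` and `‖f‖² ≤ P`. -/
def IsOCBBeamformer {L : ℕ} (sHat s : EuclideanSpace ℂ (Fin L)) (P : ℝ)
    (f : EuclideanSpace ℂ (Fin L)) : Prop :=
  (inner ℂ f sHat = 0 ∧ ‖f‖ ^ 2 ≤ P) ∧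
    ∀ g : EuclideanSpace ℂ (Fin L), inner ℂ g sHat = 0 → ‖g‖ ^ 2 ≤ P →
      ‖inner ℂ g s‖ ^ 2 ≤ ‖inner ℂ f s‖ ^ 2

namespace ChannelModel

variable {S : SystemParams} {B : ℕ} {Ω : Type*} [MeasurableSpace Ω] {μ : Measure Ω}
  (X : ChannelModel S B μ)

/-- Primary channel power. -/
def gp (w : Ω) : ℝ := ‖X.hp w‖ ^ 2

/-- Cross channel gain, normalized by the path loss. -/
def gx (w : Ω) : ℝ := ‖X.hx w‖ ^ 2 / S.lam

/-- Secondary channel gain. -/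
def gs (w : Ω) : ℝ := ‖X.hs w‖ ^ 2

/-- CDI quantization error `ε = 1 - |ŝ† s|²`. -/
def eps (w : Ω) : ℝ := 1 - ‖inner ℂ (X.sHat w) (channelShape (X.hx w))‖ ^ 2

/-- Interference margin `ω` of the primary receiver. -/
def margin (w : Ω) : ℝ := S.noise * (S.gammaP * X.gp w / S.thetaP - 1)

open Classical in
/-- Unquantized IPC signal `η` (without feedforward). -/
def eta (w : Ω) : ℝ :=
  if 0 ≤ X.margin w then X.margin w / (S.lam * X.gx w * X.eps w) else S.Pmax

/-- `p` lists, in increasing order, the equal-probability IPC codebook with `2 ^ A` elements. -/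
structure IsIPCCodebook {A : ℕ} (p : Fin (2 ^ A) → ℝ) : Prop where
  strictMono : StrictMono p
  zero : p ⟨0, Nat.two_pow_pos A⟩ = 0
  step : ∀ (n : ℕ) (h : n + 1 < 2 ^ A),
    (μ[|{w | S.thetaP ≤ S.gammaP * X.gp w}]).real
      {w | p ⟨n, Nat.lt_of_succ_lt h⟩ < X.eta w ∧ X.eta w ≤ p ⟨n + 1, h⟩} = 1 / 2 ^ A
  last : (μ[|{w | S.thetaP ≤ S.gammaP * X.gp w}]).real
      {w | p ⟨2 ^ A - 1, Nat.sub_one_lt_of_lt (Nat.two_pow_pos A)⟩ < X.eta w} = 1 / 2 ^ A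

open Classical in
/-- Quantized IPC signal `η̂`. -/
def etaHat {N : ℕ} (p : Fin N → ℝ) (w : Ω) : ℝ :=
  if 0 ≤ X.margin w ∧ X.eta w < S.Pmax then codebookFloor p (X.eta w) else S.Pmax

/-- Receive SNR of the secondary link under the beamformer `f`. -/
def snrS (f : Ω → EuclideanSpace ℂ (Fin S.L)) (w : Ω) : ℝ :=
  X.gs w / S.noise * ‖inner ℂ (f w) (channelShape (X.hs w))‖ ^ 2

/-- Outage probability of the secondary link under the beamformer `f`. -/
def outage (f : Ω → EuclideanSpace ℂ (Fin S.L)) : ℝ := μ.real {w | X.snrS f w ≤ S.thetaS}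

end ChannelModel

end

/-! Let `Y` be the squared norm of the component of `h_s` orthogonal to the quantized direction.
Rescaling this component to power `η̂` gives a feasible beamformer, so the SNR is at least `η̂ Y /
σ²`. For a fixed unit vector, unitary invariance makes `Y` a sum of `L - 1` independent unit
exponentials. This law does not depend on the direction, so `Y` is independent of everything that
determines `ω` and `η`.

Put `a = θ_p / γ_p`, `y = θ_s / γ_max` and `c = σ² θ_s`. An outage falls under one of three events.
The first is `Y ≤ y`, whose probability is the leading term.

The second has `Y > y`, `ω ≥ 0` and `η Y ≤ c`. It confines the exponential variable `g_p` to `[a, a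
+ a θ_s λ g_x ε / Y]`. Its density there is at most `e^(-a)`, so the probability is at most `e^(-a)`
times the mean length of the interval. By independence that mean factors through `E g_x = L`, `E ε =
2^(-B/(L-1)) (L-1)/L` and `E[1/Y; Y > y] = Γ(L-2, y)/Γ(L-1)`, which gives exactly the `φ` term.

In the third, rounding alone causes the outage: `η` lies in cell `n` while `p_n Y ≤ c < p_(n+1) Y`.
Each cell has probability `e^(-a) 2^(-A)` whatever its endpoints, and a given `Y` admits at most one
`n`. Summing over `n` gives at most `e^(-a) 2^(-A) P(Y > y)`, the `α` term.

The density bound leaves no remainder of second order, so `C = 0` works. The main carriers are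
`map_orthGain_prod`, `measure_eta_outage_le`, `IsIPCCodebook.measure_loss_le` and
`IsIPCCodebook.outage_subset`. -/

/-! ### Erlang laws as sums of exponential variables. -/

/-- The Erlang law with density `t ^ n / n! * e ^ (-t)` on `t > 0`, i.e. the Gamma law of shape
`n + 1` and rate `1`. -/
noncomputable def erlang (n : ℕ) : Measure ℝ :=
  (volume.restrict (Set.Ioi 0)).withDensity fun t =>
    ENNReal.ofReal (t ^ n / n.factorial * Real.exp (-t))

theorem lintegral_erlang (n : ℕ) {h : ℝ → ENNReal} (hh : Measurable h) :
    ∫⁻ t, h t ∂erlang n =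
      ∫⁻ t in Set.Ioi 0, ENNReal.ofReal (t ^ n / n.factorial * Real.exp (-t)) * h t := by
  rw [erlang, lintegral_withDensity_eq_lintegral_mul _ (by fun_prop) hh]
  rfl

theorem lintegral_pow_div_factorial (n : ℕ) {u : ℝ} (hu : 0 ≤ u) :
    ∫⁻ t in Set.Ioc 0 u, ENNReal.ofReal (t ^ n / n.factorial) =
      ENNReal.ofReal (u ^ (n + 1) / (n + 1).factorial) := by
  rw [← ofReal_integral_eq_lintegral_ofReal, ← intervalIntegral.integral_of_le hu]
  · congr 1
    simp only [intervalIntegral.integral_div, integral_pow, Nat.factorial_succ]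
    push_cast
    field_simp
    simp
  · exact ((continuous_pow n).div_const _).integrableOn_Ioc
  · exact (ae_restrict_iff' measurableSet_Ioc).2 (ae_of_all _ fun t ht => by
      have := ht.1; positivity)

/-- Substituting `u = x + t` merges the exponentials into `e^(-u)`. Tonelli then leaves the integral
of `t^n / n!` over `0 < t < u`, which raises the degree by one. -/
theorem lintegral_erlang_zero_add (n : ℕ) {h : ℝ → ENNReal} (hh : Measurable h) :
    ∫⁻ x, ∫⁻ y, h (x + y) ∂erlang n ∂erlang 0 = ∫⁻ t, h t ∂erlang (n + 1) := by
  have hm : Measurable fun x => ∫⁻ y, h (x + y) ∂erlang n := by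
    have : SFinite (erlang n) := by unfold erlang; infer_instance
    have h2 : Measurable fun p : ℝ × ℝ => h (p.1 + p.2) := by fun_prop
    exact h2.lintegral_prod_right'
  rw [lintegral_erlang _ hm, lintegral_erlang _ hh]
  have e1 : ∀ x : ℝ, ∫⁻ y, h (x + y) ∂erlang n =
      ∫⁻ t in Set.Ioi 0, ENNReal.ofReal (t ^ n / n.factorial * Real.exp (-t)) * h (x + t) :=
    fun x => lintegral_erlang n (by fun_prop)
  simp_rw [e1]
  calc ∫⁻ x in Set.Ioi (0 : ℝ), ENNReal.ofReal (x ^ 0 / (Nat.factorial 0) * Real.exp (-x)) *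
        ∫⁻ t in Set.Ioi 0, ENNReal.ofReal (t ^ n / n.factorial * Real.exp (-t)) * h (x + t)
      = ∫⁻ x in Set.Ioi (0 : ℝ), ∫⁻ t in Set.Ioi 0, ENNReal.ofReal (t ^ n / n.factorial) *
          (ENNReal.ofReal (Real.exp (-(x + t))) * h (x + t)) := by
        refine lintegral_congr fun x => ?_
        rw [← lintegral_const_mul _ (by fun_prop)]
        refine setLIntegral_congr_fun measurableSet_Ioi fun t ht => ?_
        have ht : 0 < t := ht
        rw [← mul_assoc, ← mul_assoc, ← ENNReal.ofReal_mul (by positivity),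
          ← ENNReal.ofReal_mul (by positivity), neg_add, Real.exp_add]
        congr 2
        simp
        ring
    _ = ∫⁻ t in Set.Ioi (0 : ℝ), ∫⁻ x in Set.Ioi 0, ENNReal.ofReal (t ^ n / n.factorial) *
          (ENNReal.ofReal (Real.exp (-(x + t))) * h (x + t)) :=
        lintegral_lintegral_swap (by fun_prop)
    _ = ∫⁻ t in Set.Ioi (0 : ℝ), ∫⁻ u, (Set.Ioi t).indicator (fun u =>
          ENNReal.ofReal (t ^ n / n.factorial) * (ENNReal.ofReal (Real.exp (-u)) * h u)) u := by
        refine lintegral_congr fun t => ?_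
        rw [← lintegral_indicator measurableSet_Ioi]
        refine Eq.trans ?_ (lintegral_add_right_eq_self _ t)
        refine lintegral_congr fun x => ?_
        simp [Set.indicator_apply]
    _ = ∫⁻ u, ∫⁻ t in Set.Ioi (0 : ℝ), (Set.Ioi t).indicator (fun u =>
          ENNReal.ofReal (t ^ n / n.factorial) * (ENNReal.ofReal (Real.exp (-u)) * h u)) u := by
        refine lintegral_lintegral_swap (Measurable.aemeasurable ?_)
        have : Measurable ({p : ℝ × ℝ | p.1 < p.2}.indicator fun p : ℝ × ℝ =>
            ENNReal.ofReal (p.1 ^ n / n.factorial) *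
              (ENNReal.ofReal (Real.exp (-p.2)) * h p.2)) :=
          Measurable.indicator (by fun_prop) (measurableSet_lt measurable_fst measurable_snd)
        exact this
    _ = ∫⁻ u in Set.Ioi 0, ENNReal.ofReal (u ^ (n + 1) / (n + 1).factorial * Real.exp (-u)) *
          h u := by
        rw [← lintegral_indicator measurableSet_Ioi]
        refine lintegral_congr fun u => ?_
        rcases le_or_gt u 0 with hu | hu
        · rw [Set.indicator_of_notMem (by simpa using hu)]
          refine (setLIntegral_congr_fun measurableSet_Ioi fun t ht => ?_).trans lintegral_zero
          have ht : 0 < t := ht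
          exact Set.indicator_of_notMem (by simp; linarith) _
        · rw [Set.indicator_of_mem (by simpa using hu), ENNReal.ofReal_mul (by positivity),
            ← lintegral_pow_div_factorial n hu.le, mul_assoc,
            ← lintegral_mul_const _ (by fun_prop),
            setLIntegral_congr (Ioo_ae_eq_Ioc (a := (0 : ℝ)) (b := u)).symm,
            ← lintegral_indicator measurableSet_Ioi, ← lintegral_indicator measurableSet_Ioo]
          refine lintegral_congr fun t => ?_
          simp only [Set.indicator_apply, Set.mem_Ioi, Set.mem_Ioo]
          split_ifs <;> first | rfl | (exfalso; tauto)

theorem map_norm_sq_complexNormal_one :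
    (complexNormal 1).map (fun z : ℂ => ‖z‖ ^ 2) = erlang 0 := by
  refine Measure.ext_of_lintegral _ fun h hh => ?_
  rw [lintegral_map hh (by fun_prop), complexNormal,
    lintegral_map (by fun_prop) (MeasurableEquiv.measurable _), lintegral_erlang _ hh,
    gaussianReal_of_var_ne_zero _ (by simp), prod_withDensity (by fun_prop) (by fun_prop),
    lintegral_withDensity_eq_lintegral_mul _ (by fun_prop) (by fun_prop),
    ← Measure.volume_eq_prod, ← lintegral_comp_polarCoord_symm]
  -- The two Gaussian densities of variance `1/2` multiply to `e^(-r²)/π`. Writing `r/π` as `2r ·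
  -- 1/(2π)` sets aside the Jacobian of `t = r²`, and the angular integral cancels `1/(2π)`.
  have e1 : ∀ p ∈ polarCoord.target, ENNReal.ofReal p.1 •
      ((fun z : ℝ × ℝ => gaussianPDF 0 (1 / 2) z.1 * gaussianPDF 0 (1 / 2) z.2) *
        fun a => h (‖Complex.measurableEquivRealProd.symm a‖ ^ 2)) (polarCoord.symm p) =
      (ENNReal.ofReal (2 * p.1) * (ENNReal.ofReal (Real.exp (-(p.1 ^ 2))) * h (p.1 ^ 2))) *
        ENNReal.ofReal (1 / (2 * Real.pi)) := by
    rintro ⟨r, θ⟩ hp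
    have hr : 0 < r := hp.1
    have hn : ‖Complex.measurableEquivRealProd.symm (polarCoord.symm (r, θ))‖ ^ 2 = r ^ 2 := by
      rw [Complex.measurableEquivRealProd_symm_apply, ← Complex.normSq_eq_norm_sq,
        Complex.normSq_mk]
      simp only [polarCoord_symm_apply]
      linear_combination r ^ 2 * Real.sin_sq_add_cos_sq θ
    simp only [Pi.mul_apply, hn, smul_eq_mul]
    simp only [gaussianPDF, gaussianPDFReal, polarCoord_symm_apply]
    rw [← ENNReal.ofReal_mul (by positivity), ← mul_assoc, ← ENNReal.ofReal_mul hr.le,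
      ← mul_assoc (ENNReal.ofReal (2 * r)), ← ENNReal.ofReal_mul (by positivity),
      mul_right_comm _ (h (r ^ 2)), ← ENNReal.ofReal_mul (by positivity)]
    congr 2
    have : Real.exp (-(r ^ 2)) = Real.exp (-(r * Real.cos θ - 0) ^ 2 / (2 * ((1 / 2 : NNReal) : ℝ)))
        * Real.exp (-(r * Real.sin θ - 0) ^ 2 / (2 * ((1 / 2 : NNReal) : ℝ))) := by
      rw [← Real.exp_add]
      congr 1
      push_cast
      linear_combination r ^ 2 * Real.sin_sq_add_cos_sq θ
    rw [this]
    have h3 : (√(2 * Real.pi * ((1 / 2 : NNReal) : ℝ)))⁻¹ *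
        (√(2 * Real.pi * ((1 / 2 : NNReal) : ℝ)))⁻¹ = 1 / Real.pi := by
      rw [← mul_inv, Real.mul_self_sqrt (by positivity)]
      push_cast
      ring_nf
    have h4 : 1 / (2 * Real.pi) = 1 / Real.pi / 2 := by ring
    rw [h4, ← h3]
    ring
  rw [setLIntegral_congr_fun (by
      rw [polarCoord_target]; exact measurableSet_Ioi.prod measurableSet_Ioo) e1,
    polarCoord_target, Measure.volume_eq_prod, ← Measure.prod_restrict,
    lintegral_prod _ (by fun_prop)]
  simp only [lintegral_const, Measure.restrict_apply, MeasurableSet.univ, Set.univ_inter,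
    Real.volume_Ioo]
  have e2 : ENNReal.ofReal (1 / (2 * Real.pi)) * ENNReal.ofReal (Real.pi - -Real.pi) = 1 := by
    rw [← ENNReal.ofReal_mul (by positivity), ← ENNReal.ofReal_one]
    congr 1
    field_simp
    ring
  simp_rw [mul_assoc, e2, mul_one]
  have hi : (fun r : ℝ => r ^ 2) '' Set.Ioi 0 = Set.Ioi 0 := by
    ext x
    constructor
    · rintro ⟨r, hr, rfl⟩
      have hr : 0 < r := hr
      exact Set.mem_Ioi.2 (by positivity)
    · intro hx
      exact ⟨√x, Real.sqrt_pos.2 hx, Real.sq_sqrt (le_of_lt hx)⟩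
  have key := lintegral_image_eq_lintegral_abs_deriv_mul (s := Set.Ioi (0 : ℝ))
    (f := fun r => r ^ 2) (f' := fun r => 2 * r) measurableSet_Ioi
    (fun x _ => by simpa using (hasDerivAt_pow 2 x).hasDerivWithinAt)
    (fun x hx y hy hxy => by
      have hx : 0 < x := hx
      have hy : 0 < y := hy
      exact (pow_left_inj₀ hx.le hy.le two_ne_zero).1 hxy)
    (fun t => ENNReal.ofReal (Real.exp (-t)) * h t)
  rw [hi] at key
  simp only [pow_zero, Nat.factorial_zero, Nat.cast_one, div_one, one_mul]
  rw [key]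
  refine setLIntegral_congr_fun measurableSet_Ioi fun r hr => ?_
  have hr : 0 < r := hr
  rw [abs_of_pos (by positivity)]

instance (v : NNReal) : IsProbabilityMeasure (complexNormal v) := by
  unfold complexNormal
  exact Measure.isProbabilityMeasure_map (MeasurableEquiv.measurable _).aemeasurable

instance : IsProbabilityMeasure (erlang 0) := by
  rw [← map_norm_sq_complexNormal_one]
  exact Measure.isProbabilityMeasure_map (by fun_prop)

theorem map_sum_pi_erlang_zero (n : ℕ) :
    (Measure.pi fun _ : Fin (n + 1) => erlang 0).map (fun x => ∑ i, x i) = erlang n := by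
  induction n with
  | zero =>
    simp only [Nat.reduceAdd, Finset.univ_unique, Finset.sum_singleton]
    exact (measurePreserving_eval (fun _ : Fin 1 => erlang 0) default).map_eq
  | succ n ih =>
    refine Measure.ext_of_lintegral _ fun h hh => ?_
    have hmp := (measurePreserving_piFinSuccAbove (fun _ : Fin (n + 2) => erlang 0) 0).symm
    rw [lintegral_map hh (by fun_prop), ← hmp.map_eq,
      lintegral_map (by fun_prop) (MeasurableEquiv.measurable _),
      lintegral_prod _ (by fun_prop), ← lintegral_erlang_zero_add n hh]
    refine lintegral_congr fun x => ?_
    rw [← ih, lintegral_map (by fun_prop) (by fun_prop)]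
    refine lintegral_congr fun y => ?_
    simp [MeasurableEquiv.piFinSuccAbove_symm_apply, Fin.sum_univ_succ]

/-! ### Unitary invariance of complex Gaussian vectors. -/

/-- The law of a vector with i.i.d. `CN(0, v)` entries. -/
noncomputable def complexNormalVector (v : NNReal) (L : ℕ) : Measure (EuclideanSpace ℂ (Fin L)) :=
  (Measure.pi fun _ => complexNormal v).map (WithLp.toLp 2)

instance (v : NNReal) (L : ℕ) : IsProbabilityMeasure (complexNormalVector v L) := by
  unfold complexNormalVector
  exact Measure.isProbabilityMeasure_map (by fun_prop)

theorem charFun_complexNormal_one (t : ℂ) :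
    charFun (complexNormal 1) t = Complex.exp (-((‖t‖ ^ 2 : ℝ) : ℂ) / 4) := by
  have h : ∀ p : ℝ × ℝ, Complex.exp
      (((inner ℝ (Complex.measurableEquivRealProd.symm p) t : ℝ) : ℂ) * Complex.I) =
      Complex.exp (t.re * p.1 * Complex.I) * Complex.exp (t.im * p.2 * Complex.I) := by
    intro p
    rw [← Complex.exp_add, Complex.inner, Complex.measurableEquivRealProd_symm_apply]
    congr 1
    simp
    ring
  rw [charFun_apply, complexNormal, integral_map_equiv]
  simp_rw [h]
  rw [integral_prod_mul (fun x : ℝ => Complex.exp (t.re * x * Complex.I))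
      (fun x : ℝ => Complex.exp (t.im * x * Complex.I)), ← charFun_apply_real,
    ← charFun_apply_real, charFun_gaussianReal, charFun_gaussianReal, ← Complex.exp_add,
    ← Complex.normSq_eq_norm_sq, Complex.normSq_apply]
  congr 1
  push_cast
  ring

/-- The characteristic function depends on `t` only through its norm, which is what makes the law
unitarily invariant. -/
theorem charFun_complexNormalVector_one {L : ℕ} (t : EuclideanSpace ℂ (Fin L)) :
    charFun (complexNormalVector 1 L) t = Complex.exp (-((‖t‖ ^ 2 : ℝ) : ℂ) / 4) := by
  rw [complexNormalVector, charFun_pi]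
  simp_rw [charFun_complexNormal_one]
  rw [← Complex.exp_sum, EuclideanSpace.norm_sq_eq]
  congr 1
  push_cast
  rw [← Finset.sum_div, Finset.sum_neg_distrib]

/-- The i.i.d. complex Gaussian law is invariant under unitary maps. -/
theorem map_linearIsometryEquiv_complexNormalVector_one {L : ℕ}
    (U : EuclideanSpace ℂ (Fin L) ≃ₗᵢ[ℂ] EuclideanSpace ℂ (Fin L)) :
    (complexNormalVector 1 L).map U = complexNormalVector 1 L := by
  have hU : Measurable U := U.continuous.measurable
  have := Measure.isProbabilityMeasure_map (μ := complexNormalVector 1 L) hU.aemeasurable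
  refine Measure.ext_of_charFun (funext fun t => ?_)
  rw [charFun_apply, integral_map hU.aemeasurable (by fun_prop), charFun_complexNormalVector_one]
  have h : ∀ x, inner ℝ (U x) t = inner ℝ x (U.symm t) := fun x => by
    -- Characteristic functions use the real inner product, so the unitary map is viewed as a real
    -- isometry.
    let V : EuclideanSpace ℂ (Fin L) ≃ₗᵢ[ℝ] EuclideanSpace ℂ (Fin L) :=
      ⟨U.toLinearEquiv.restrictScalars ℝ, U.norm_map⟩
    have : inner ℝ (U x) (U (U.symm t)) = inner ℝ x (U.symm t) := V.inner_map_map x (U.symm t)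
    rwa [U.apply_symm_apply] at this
  simp_rw [h]
  rw [← charFun_apply, charFun_complexNormalVector_one, U.symm.norm_map]

theorem map_sum_succ_complexNormal (n : ℕ) :
    (Measure.pi fun _ : Fin (n + 2) => complexNormal 1).map
      (fun z => ∑ i : Fin (n + 1), ‖z i.succ‖ ^ 2) = erlang n := by
  have h1 : (Measure.pi fun _ : Fin (n + 2) => complexNormal 1).map
      (fun z (i : Fin (n + 1)) => z i.succ) = Measure.pi fun _ => complexNormal 1 := by
    have h := (measurePreserving_snd (μ := complexNormal 1)
      (ν := Measure.pi fun _ : Fin (n + 1) => complexNormal 1)).comp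
      (measurePreserving_piFinSuccAbove (fun _ : Fin (n + 2) => complexNormal 1) 0)
    exact h.map_eq
  have h2 := Measure.pi_map_pi (μ := fun _ : Fin (n + 1) => complexNormal 1)
    (f := fun _ (z : ℂ) => ‖z‖ ^ 2) (hμ := fun _ => by
      rw [map_norm_sq_complexNormal_one]; infer_instance) (fun _ => by fun_prop)
  rw [← map_sum_pi_erlang_zero n, ← map_norm_sq_complexNormal_one, ← h2, ← h1,
    Measure.map_map (by fun_prop) (by fun_prop), Measure.map_map (by fun_prop) (by fun_prop)]
  rfl

/-- Removing from a complex Gaussian vector its component along a unit vector leaves a squared norm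
with the Erlang law. -/
theorem map_norm_sq_sub_complexNormalVector_one {L n : ℕ} (hL : L = n + 2)
    {e : EuclideanSpace ℂ (Fin L)} (he : ‖e‖ = 1) :
    (complexNormalVector 1 L).map (fun h => ‖h‖ ^ 2 - ‖inner ℂ e h‖ ^ 2) = erlang n := by
  subst hL
  -- Extending `e` to an orthonormal basis makes the component along `e` the coordinate of index
  -- `0`; by Parseval, the other `n + 1` coordinates carry the difference.
  obtain ⟨b, hb⟩ := Orthonormal.exists_orthonormalBasis_extension_of_card_eq (𝕜 := ℂ)
    (E := EuclideanSpace ℂ (Fin (n + 2))) (ι := Fin (n + 2)) (by simp) (v := fun _ => e)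
    (s := {0}) (by
      rw [orthonormal_iff_ite]
      rintro ⟨i, rfl⟩ ⟨j, rfl⟩
      simp [he])
  have hb0 : b 0 = e := hb 0 rfl
  have hY : ∀ h : EuclideanSpace ℂ (Fin (n + 2)), ‖h‖ ^ 2 - ‖inner ℂ e h‖ ^ 2 =
      ∑ i : Fin (n + 1), ‖b.repr h i.succ‖ ^ 2 := fun h => by
    rw [← b.repr.norm_map h, EuclideanSpace.norm_sq_eq, Fin.sum_univ_succ, b.repr_apply_apply,
      hb0]
    ring
  simp_rw [hY]
  have hU : Measurable b.repr := b.repr.continuous.measurable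
  have hg : Measurable fun z : EuclideanSpace ℂ (Fin (n + 2)) =>
    ∑ i : Fin (n + 1), ‖z i.succ‖ ^ 2 := by fun_prop
  have := Measure.map_map (μ := complexNormalVector 1 (n + 2)) hg hU
  rw [map_linearIsometryEquiv_complexNormalVector_one] at this
  rw [← map_sum_succ_complexNormal n]
  refine this.symm.trans ?_
  rw [complexNormalVector, Measure.map_map hg (by fun_prop)]
  rfl

/-! ### Second moments, and absence of an atom at zero. -/

theorem lintegral_sq_gaussianReal (v : NNReal) :
    ∫⁻ x, ENNReal.ofReal (x ^ 2) ∂gaussianReal 0 v = v := by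
  have h := evariance_eq_lintegral_ofReal (fun x : ℝ => x) (gaussianReal 0 v)
  rw [← ofReal_variance (X := fun x : ℝ => x) (memLp_id_gaussianReal 2), variance_fun_id_gaussianReal,
    integral_id_gaussianReal] at h
  simpa using h.symm

theorem lintegral_norm_sq_complexNormal (v : NNReal) :
    ∫⁻ z, ENNReal.ofReal (‖z‖ ^ 2) ∂complexNormal v = v := by
  rw [complexNormal, lintegral_map (by fun_prop) (MeasurableEquiv.measurable _)]
  have h : ∀ p : ℝ × ℝ, ENNReal.ofReal (‖Complex.measurableEquivRealProd.symm p‖ ^ 2) =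
      ENNReal.ofReal (p.1 ^ 2) + ENNReal.ofReal (p.2 ^ 2) := fun p => by
    rw [← ENNReal.ofReal_add (by positivity) (by positivity),
      Complex.measurableEquivRealProd_symm_apply, ← Complex.normSq_eq_norm_sq, Complex.normSq_mk]
    congr 1
    ring
  simp_rw [h]
  rw [lintegral_prod _ (by fun_prop)]
  simp only [measurable_const, lintegral_add_left, lintegral_const, measure_univ, mul_one,
    lintegral_sq_gaussianReal]
  rw [lintegral_add_right _ measurable_const]
  simp only [lintegral_const, measure_univ, mul_one, lintegral_sq_gaussianReal]
  rw [← ENNReal.coe_add, add_halves]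

theorem lintegral_norm_sq_complexNormalVector (v : NNReal) (L : ℕ) :
    ∫⁻ h, ENNReal.ofReal (‖h‖ ^ 2) ∂complexNormalVector v L = L * v := by
  rw [complexNormalVector, lintegral_map (by fun_prop) (by fun_prop)]
  simp_rw [EuclideanSpace.norm_sq_eq]
  have h : ∀ x : Fin L → ℂ, ENNReal.ofReal (∑ i, ‖x i‖ ^ 2) =
      ∑ i, ENNReal.ofReal (‖x i‖ ^ 2) :=
    fun x => ENNReal.ofReal_sum_of_nonneg fun i _ => by positivity
  simp_rw [h]
  rw [lintegral_finsetSum _ (fun i _ => by fun_prop)]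
  have h2 : ∀ i : Fin L, ∫⁻ x, ENNReal.ofReal (‖x i‖ ^ 2)
      ∂(Measure.pi fun _ : Fin L => complexNormal v) = v := fun i => by
    rw [← lintegral_norm_sq_complexNormal v,
      ← (measurePreserving_eval (fun _ : Fin L => complexNormal v) i).lintegral_comp
        (f := fun z => ENNReal.ofReal (‖z‖ ^ 2)) (by fun_prop)]
  simp only [h2, Finset.sum_const, Finset.card_univ, Fintype.card_fin, nsmul_eq_mul]

theorem complexNormalVector_singleton_zero {v : NNReal} (hv : v ≠ 0) {L : ℕ} (hL : L ≠ 0) :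
    complexNormalVector v L {0} = 0 := by
  have h0 : complexNormal v {0} = 0 := by
    have : NullSingletonClass (gaussianReal 0 (v / 2)) :=
      nullSingletonClass_gaussianReal (by simpa using hv)
    rw [complexNormal, Measure.map_apply (MeasurableEquiv.measurable _) (measurableSet_singleton 0)]
    have : (Complex.measurableEquivRealProd.symm ⁻¹' {0} : Set (ℝ × ℝ)) = {0} ×ˢ {0} := by
      ext p
      simp [Complex.measurableEquivRealProd_symm_apply, Complex.ext_iff, Prod.ext_iff]
    rw [this, Measure.prod_prod]
    simp
  rw [complexNormalVector, Measure.map_apply (by fun_prop) (measurableSet_singleton 0)]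
  have : (WithLp.toLp 2 ⁻¹' {(0 : EuclideanSpace ℂ (Fin L))} : Set (Fin L → ℂ)) =
      Set.univ.pi fun _ => {0} := by
    ext p
    simp [funext_iff]
  rw [this, Measure.pi_pi]
  simp [h0, hL]

/-! ### Tails and truncated inverse moments of Erlang laws. -/

/-- Away from the origin `t^(s-1) ≤ t^s / y`, so the Gamma integral of parameter `s + 1` dominates.
This admits `s = 0`, the case `Γ(L-2, ·)` with `L = 2`. -/
theorem integrableOn_rpow_mul_exp_neg_Ioi {s y : ℝ} (hs : 0 ≤ s) (hy : 0 < y) :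
    IntegrableOn (fun t : ℝ => t ^ (s - 1) * Real.exp (-t)) (Set.Ioi y) := by
  have h1 : IntegrableOn (fun t : ℝ => y⁻¹ * (Real.exp (-t) * t ^ (s + 1 - 1))) (Set.Ioi y) :=
    ((Real.GammaIntegral_convergent (s := s + 1) (by linarith)).mono_set
      (Set.Ioi_subset_Ioi hy.le)).const_mul _
  refine Integrable.mono' h1 (by fun_prop) ?_
  refine (ae_restrict_iff' measurableSet_Ioi).2 (ae_of_all _ fun t ht => ?_)
  have ht : y < t := ht
  have ht0 : 0 < t := hy.trans ht
  rw [Real.norm_of_nonneg (by positivity), add_sub_cancel_right, Real.rpow_sub_one ht0.ne',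
    div_eq_mul_inv]
  have : t⁻¹ ≤ y⁻¹ := inv_anti₀ hy ht.le
  have h3 : 0 ≤ t ^ s * Real.exp (-t) := by positivity
  nlinarith

theorem erlang_Ioi {n : ℕ} {s y : ℝ} (hs : s = n + 1) (hy : 0 < y) :
    erlang n (Set.Ioi y) = ENNReal.ofReal (upperGamma s y / Real.Gamma s) := by
  subst hs
  rw [erlang, withDensity_apply _ measurableSet_Ioi, Measure.restrict_restrict measurableSet_Ioi,
    Set.inter_eq_left.2 (Set.Ioi_subset_Ioi hy.le), upperGamma, ← integral_div,
    ofReal_integral_eq_lintegral_ofReal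
      ((integrableOn_rpow_mul_exp_neg_Ioi (by positivity) hy).div_const _)
      ((ae_restrict_iff' measurableSet_Ioi).2 (ae_of_all _ fun t ht => by
        have ht0 : 0 < t := hy.trans ht
        have := Real.Gamma_pos_of_pos (s := (n : ℝ) + 1) (by positivity)
        positivity))]
  refine setLIntegral_congr_fun measurableSet_Ioi fun t ht => ?_
  rw [add_sub_cancel_right, Real.rpow_natCast, Real.Gamma_nat_eq_factorial]
  congr 1
  ring

theorem lintegral_Ioi_inv_erlang {n : ℕ} {s y : ℝ} (hs : s = n + 1) (hy : 0 < y) :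
    ∫⁻ t in Set.Ioi y, ENNReal.ofReal t⁻¹ ∂erlang n =
      ENNReal.ofReal (upperGamma (s - 1) y / Real.Gamma s) := by
  subst hs
  rw [← lintegral_indicator measurableSet_Ioi,
    lintegral_erlang _ (Measurable.indicator (by fun_prop) measurableSet_Ioi), upperGamma,
    ← integral_div, ofReal_integral_eq_lintegral_ofReal
      ((integrableOn_rpow_mul_exp_neg_Ioi (by simp) hy).div_const _)
      ((ae_restrict_iff' measurableSet_Ioi).2 (ae_of_all _ fun t ht => by
        have ht0 : 0 < t := hy.trans ht
        have := Real.Gamma_pos_of_pos (s := (n : ℝ) + 1) (by positivity)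
        positivity)), ← lintegral_indicator measurableSet_Ioi,
    ← lintegral_indicator measurableSet_Ioi]
  refine lintegral_congr fun t => ?_
  simp only [Set.indicator_apply, Set.mem_Ioi]
  by_cases ht : y < t
  · have ht0 : 0 < t := hy.trans ht
    rw [if_pos ht0, if_pos ht, if_pos ht, ← ENNReal.ofReal_mul (by positivity),
      add_sub_cancel_right, Real.rpow_sub_one ht0.ne', Real.rpow_natCast,
      Real.Gamma_nat_eq_factorial]
    congr 1
    field_simp
  · simp [ht]

theorem erlang_zero_Ici {a : ℝ} (ha : 0 < a) :
    erlang 0 (Set.Ici a) = ENNReal.ofReal (Real.exp (-a)) := by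
  have hac : erlang 0 ≪ volume :=
    (withDensity_absolutelyContinuous _ _).trans Measure.absolutelyContinuous_restrict
  rw [← measure_congr (hac.ae_le (Ioi_ae_eq_Ici (a := a))),
    erlang_Ioi (s := 1) (by simp) ha, upperGamma]
  simp [integral_exp_Iic]

/-- The density is at most its value `e^(-a)` at the left end. Using this one-sided bound in place
of an expansion avoids any quadratic remainder. -/
theorem erlang_zero_Icc_le {a d : ℝ} :
    erlang 0 (Set.Icc a (a + d)) ≤ ENNReal.ofReal (Real.exp (-a) * d) := by
  rw [erlang, withDensity_apply _ measurableSet_Icc]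
  calc ∫⁻ t in Set.Icc a (a + d), ENNReal.ofReal (t ^ 0 / (Nat.factorial 0) * Real.exp (-t))
        ∂(volume.restrict (Set.Ioi 0))
      ≤ ∫⁻ t in Set.Icc a (a + d), ENNReal.ofReal (t ^ 0 / (Nat.factorial 0) * Real.exp (-t)) :=
        lintegral_mono' (Measure.restrict_mono le_rfl Measure.restrict_le_self) le_rfl
    _ ≤ ∫⁻ t in Set.Icc a (a + d), ENNReal.ofReal (Real.exp (-a)) := by
        refine setLIntegral_mono measurable_const fun t ht => ENNReal.ofReal_le_ofReal ?_
        simpa using ht.1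
    _ = ENNReal.ofReal (Real.exp (-a) * d) := by
        rw [lintegral_const, Measure.restrict_apply MeasurableSet.univ, Set.univ_inter,
          Real.volume_Icc, add_sub_cancel_left, ENNReal.ofReal_mul (by positivity)]

/-! ### Two general probability estimates. -/

/-- Mean of a variable with distribution function `min (K τ ^ m) 1`. -/
theorem lintegral_le_of_cdf_pow {Ω : Type*} [MeasurableSpace Ω] {μ : Measure Ω}
    [IsProbabilityMeasure μ] {ε : Ω → ℝ} (hε : Measurable ε) (h0 : ∀ w, 0 ≤ ε w) {K b : ℝ} {m : ℕ}
    (hb : 0 < b) (hK : K * b ^ m = 1)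
    (hle : ∀ τ, 0 ≤ τ → τ ≤ b → μ.real {w | ε w ≤ τ} = K * τ ^ m)
    (hgt : ∀ τ, b < τ → μ.real {w | ε w ≤ τ} = 1) :
    ∫⁻ w, ENNReal.ofReal (ε w) ∂μ ≤ ENNReal.ofReal (b * (m / (m + 1))) := by
  -- Layer-cake formula: the mean is the integral of the tail, which is `1 - K τ^m` up to `b` and
  -- zero beyond.
  rw [lintegral_eq_lintegral_meas_lt μ (ae_of_all _ h0) hε.aemeasurable]
  have hc : ∀ τ, μ {w | τ < ε w} = ENNReal.ofReal (1 - μ.real {w | ε w ≤ τ}) := fun τ => by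
    rw [← probReal_compl_eq_one_sub (measurableSet_le hε measurable_const), ofReal_measureReal]
    congr 1
    ext w
    simp
  have hKp : 0 ≤ K := by
    by_contra! hneg
    have : K * b ^ m ≤ 0 := mul_nonpos_of_nonpos_of_nonneg hneg.le (by positivity)
    linarith
  calc ∫⁻ t in Set.Ioi 0, μ {w | t < ε w}
      ≤ ∫⁻ t in Set.Ioi 0, (Set.Ioc 0 b).indicator (fun t => ENNReal.ofReal (1 - K * t ^ m)) t := by
        refine setLIntegral_mono (Measurable.indicator (by fun_prop) measurableSet_Ioc)
          fun t ht => ?_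
        have ht : 0 < t := ht
        rw [hc]
        by_cases htb : t ≤ b
        · rw [Set.indicator_of_mem (by exact ⟨ht, htb⟩), hle t ht.le htb]
        · rw [hgt t (not_le.1 htb)]
          simp
    _ ≤ ∫⁻ t in Set.Ioc 0 b, ENNReal.ofReal (1 - K * t ^ m) := by
        rw [← lintegral_indicator measurableSet_Ioc]
        exact lintegral_mono' Measure.restrict_le_self le_rfl
    _ = ENNReal.ofReal (b * (m / (m + 1))) := by
        rw [← ofReal_integral_eq_lintegral_ofReal, ← intervalIntegral.integral_of_le hb.le]
        · congr 1
          rw [intervalIntegral.integral_sub (by simp)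
            (Continuous.intervalIntegrable (by fun_prop) _ _)]
          simp only [intervalIntegral.integral_const, intervalIntegral.integral_const_mul,
            integral_pow, smul_eq_mul]
          rw [pow_succ]
          field_simp
          simp
          linear_combination (-b) * hK
        · exact Continuous.integrableOn_Ioc (by fun_prop)
        · refine (ae_restrict_iff' measurableSet_Ioc).2 (ae_of_all _ fun t ht => ?_)
          have h1 : K * t ^ m ≤ K * b ^ m :=
            mul_le_mul_of_nonneg_left (pow_le_pow_left₀ ht.1.le ht.2 m) hKp
          simp only [Pi.zero_apply]
          linarith

/-- An exponential variable falls into a random interval `[a, a + k V / Y]` with probability at most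
`e ^ (-a)` times the mean length of the interval. -/
theorem measure_exponential_mem_Icc_le {Ω : Type*} [MeasurableSpace Ω] {μ : Measure Ω}
    [IsProbabilityMeasure μ] {U V Y : Ω → ℝ} (hU : Measurable U) (hV : Measurable V)
    (hY : Measurable Y) (hUlaw : μ.map U = erlang 0) (hUV : IndepFun U V μ)
    (hUVY : IndepFun (fun w => (U w, V w)) Y μ) {a k y : ℝ} (hk : 0 ≤ k) (hy : 0 < y) :
    μ {w | y < Y w ∧ U w ∈ Set.Icc a (a + k * V w / Y w)} ≤
      ENNReal.ofReal (Real.exp (-a) * k) * (∫⁻ w, ENNReal.ofReal (V w) ∂μ) *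
        ∫⁻ t in Set.Ioi y, ENNReal.ofReal t⁻¹ ∂μ.map Y := by
  have := Measure.isProbabilityMeasure_map (μ := μ) hU.aemeasurable
  have := Measure.isProbabilityMeasure_map (μ := μ) hV.aemeasurable
  have := Measure.isProbabilityMeasure_map (μ := μ) hY.aemeasurable
  -- The joint law is a product. With `V = v` and `Y = t` fixed, the slice in `U` is an interval of
  -- length `k v / t`; integrating the resulting bound separates the means of `V` and `1/Y`.
  have hlaw : μ.map (fun w => ((U w, V w), Y w)) = ((μ.map U).prod (μ.map V)).prod (μ.map Y) := by
    rw [← (indepFun_iff_map_prod_eq_prod_map_map hU.aemeasurable hV.aemeasurable).1 hUV]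
    exact (indepFun_iff_map_prod_eq_prod_map_map (by fun_prop) hY.aemeasurable).1 hUVY
  set T : Set ((ℝ × ℝ) × ℝ) :=
    {q | y < q.2 ∧ a ≤ q.1.1 ∧ q.1.1 ≤ a + k * q.1.2 / q.2} with hT
  have hTm : MeasurableSet T :=
    (measurableSet_lt measurable_const measurable_snd).inter
      ((measurableSet_le measurable_const (by fun_prop : Measurable fun q : (ℝ × ℝ) × ℝ =>
        q.1.1)).inter (measurableSet_le (by fun_prop : Measurable fun q : (ℝ × ℝ) × ℝ => q.1.1)
          (by fun_prop : Measurable fun q : (ℝ × ℝ) × ℝ => a + k * q.1.2 / q.2)))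
  have h1 : μ {w | y < Y w ∧ U w ∈ Set.Icc a (a + k * V w / Y w)} =
      μ.map (fun w => ((U w, V w), Y w)) T := by
    rw [Measure.map_apply (by fun_prop) hTm]
    rfl
  rw [h1, hlaw, Measure.prod_apply_symm hTm, ← lintegral_indicator measurableSet_Ioi,
    ← lintegral_map (f := fun v : ℝ => ENNReal.ofReal v) (by fun_prop) hV,
    ← lintegral_const_mul _ (Measurable.indicator (by fun_prop) measurableSet_Ioi)]
  refine lintegral_mono fun t => ?_
  by_cases ht : y < t
  · have ht0 : 0 < t := hy.trans ht
    rw [Set.indicator_of_mem (by exact ht), Measure.prod_apply_symm (by measurability), hUlaw,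
      ← lintegral_const_mul _ (by fun_prop), ← lintegral_mul_const _ (by fun_prop)]
    refine lintegral_mono fun v => ?_
    have h2 : (fun u : ℝ => (u, v)) ⁻¹' ((fun q : ℝ × ℝ => (q, t)) ⁻¹' T) =
        Set.Icc a (a + k * v / t) := by
      ext u
      simp [hT, ht]
    rw [h2, ← ENNReal.ofReal_mul (by positivity), ← ENNReal.ofReal_mul' (by positivity)]
    refine erlang_zero_Icc_le.trans_eq ?_
    congr 1
    ring
  · have h2 : ((fun q : ℝ × ℝ => (q, t)) ⁻¹' T) = ∅ := by
      ext u
      simp [hT, ht]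
    rw [h2]
    simp

/-! ### Orthogonal beamforming and channel shapes. -/

/-- A beamformer orthogonal to `e` reaches at least the power `P` times the squared length of the
component of `s` orthogonal to `e`. -/
theorem IsOCBBeamformer.le_norm_inner_sq {L : ℕ} {e s f : EuclideanSpace ℂ (Fin L)} {P : ℝ}
    (h : IsOCBBeamformer e s P f) (he : ‖e‖ = 1) :
    P * (‖s‖ ^ 2 - ‖inner ℂ e s‖ ^ 2) ≤ ‖inner ℂ f s‖ ^ 2 := by
  obtain ⟨⟨-, hP⟩, hmax⟩ := h
  have hP0 : 0 ≤ P := le_trans (by positivity) hP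
  set c : ℂ := inner ℂ e s with hc
  set v := s - c • e with hv
  have hve : inner ℂ v e = 0 := by
    rw [hv, inner_sub_left, inner_smul_left, inner_self_eq_norm_sq_to_K, he, hc,
      inner_conj_symm]
    simp
  have hvs : inner ℂ v s = ((‖v‖ ^ 2 : ℝ) : ℂ) := by
    have : s = v + c • e := by simp [hv]
    conv_lhs => rw [this]
    rw [inner_add_right, inner_smul_right, hve, inner_self_eq_norm_sq_to_K]
    simp
  have hnorm : ‖v‖ ^ 2 = ‖s‖ ^ 2 - ‖c‖ ^ 2 := by
    have : s = v + c • e := by simp [hv]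
    have h2 : ‖s‖ ^ 2 = ‖v‖ ^ 2 + ‖c • e‖ ^ 2 := by
      have := norm_add_sq_eq_norm_sq_add_norm_sq_of_inner_eq_zero v (c • e)
        (𝕜 := ℂ) (by rw [inner_smul_right, hve, mul_zero])
      rw [← ‹s = v + c • e›] at this
      simpa [sq] using this
    rw [norm_smul, he, mul_one] at h2
    linarith
  rw [← hnorm]
  by_cases hv0 : ‖v‖ = 0
  · rw [hv0]
    simp
  have hv1 : 0 < ‖v‖ := lt_of_le_of_ne (norm_nonneg _) (Ne.symm hv0)
  have hr : 0 ≤ √P / ‖v‖ := by positivity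
  -- The competitor is the projection `v` of `s` rescaled to norm `√P`, so that it spends the whole
  -- power.
  have hg := hmax (((√P / ‖v‖ : ℝ) : ℂ) • v) (by rw [inner_smul_left, hve, mul_zero])
    (by
      rw [norm_smul, Complex.norm_real, Real.norm_of_nonneg hr, div_mul_cancel₀ _ hv0,
        Real.sq_sqrt hP0])
  refine le_trans (le_of_eq ?_) hg
  rw [inner_smul_left, hvs, Complex.conj_ofReal, ← Complex.ofReal_mul, Complex.norm_real,
    Real.norm_of_nonneg (by positivity)]
  have : √P / ‖v‖ * ‖v‖ ^ 2 = √P * ‖v‖ := by field_simp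
  rw [this, mul_pow, Real.sq_sqrt hP0]

@[fun_prop]
theorem measurable_channelShape {L : ℕ} :
    Measurable (channelShape : EuclideanSpace ℂ (Fin L) → EuclideanSpace ℂ (Fin L)) := by
  unfold channelShape
  exact Measurable.smul (f := fun h : EuclideanSpace ℂ (Fin L) => ((‖h‖⁻¹ : ℝ) : ℂ))
    (by fun_prop) measurable_id

theorem norm_channelShape_le_one {L : ℕ} (h : EuclideanSpace ℂ (Fin L)) :
    ‖channelShape h‖ ≤ 1 := by
  rw [channelShape, norm_smul, Complex.norm_real, Real.norm_of_nonneg (by positivity)]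
  exact inv_mul_le_one

theorem norm_smul_channelShape {L : ℕ} (h : EuclideanSpace ℂ (Fin L)) :
    ((‖h‖ : ℝ) : ℂ) • channelShape h = h := by
  by_cases h0 : h = 0
  · simp [h0]
  · rw [channelShape, smul_smul, ← Complex.ofReal_mul, mul_inv_cancel₀ (norm_ne_zero_iff.2 h0)]
    simp

theorem map_eq_complexNormalVector {Ω : Type*} [MeasurableSpace Ω] {μ : Measure Ω} {L : ℕ}
    {h : Ω → EuclideanSpace ℂ (Fin L)} (hm : Measurable h) {v : NNReal}
    (hlaw : μ.map (fun w i => h w i) = Measure.pi fun _ => complexNormal v) :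
    μ.map h = complexNormalVector v L := by
  rw [complexNormalVector, ← hlaw, Measure.map_map (by fun_prop) (by fun_prop)]
  rfl

namespace SystemParams

variable (S : SystemParams)

theorem gammaP_pos : 0 < S.gammaP := div_pos S.Pp_pos S.noise_pos

theorem gammaMax_pos : 0 < S.gammaMax := div_pos S.Pmax_pos S.noise_pos

end SystemParams

/-! ### The gain orthogonal to the quantized cross channel. -/

namespace ChannelModel

variable {S : SystemParams} {B : ℕ} {Ω : Type*} [MeasurableSpace Ω] {μ : Measure Ω}
  (X : ChannelModel S B μ)

/-- Gain of the secondary channel orthogonally to the quantized cross channel. -/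
noncomputable def orthGain (w : Ω) : ℝ :=
  ‖X.hs w‖ ^ 2 - ‖inner ℂ (X.sHat w) (X.hs w)‖ ^ 2

theorem orthGain_nonneg (w : Ω) : 0 ≤ X.orthGain w := by
  have h := norm_inner_le_norm (𝕜 := ℂ) (X.sHat w) (X.hs w)
  rw [X.norm_sHat, one_mul] at h
  exact sub_nonneg.2 (pow_le_pow_left₀ (norm_nonneg _) h 2)

@[fun_prop]
theorem measurable_orthGain : Measurable X.orthGain := by
  have h1 := X.measurable_hs
  have h2 := X.measurable_sHat
  unfold orthGain
  fun_prop

/-- Both squared norms scale by `‖h_s‖²`; the identity also survives `h_s = 0`, where the shape is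
zero. -/
theorem gs_mul_sub (w : Ω) :
    X.gs w * (‖channelShape (X.hs w)‖ ^ 2 -
      ‖inner ℂ (X.sHat w) (channelShape (X.hs w))‖ ^ 2) = X.orthGain w := by
  have h := norm_smul_channelShape (X.hs w)
  have h1 : ‖X.hs w‖ = ‖X.hs w‖ * ‖channelShape (X.hs w)‖ := by
    conv_lhs => rw [← h]
    rw [norm_smul, Complex.norm_real, norm_norm]
  have h2 : ‖inner ℂ (X.sHat w) (X.hs w)‖ =
      ‖X.hs w‖ * ‖inner ℂ (X.sHat w) (channelShape (X.hs w))‖ := by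
    conv_lhs => rw [← h]
    rw [inner_smul_right, norm_mul, Complex.norm_real, norm_norm]
  rw [orthGain, h2, gs, mul_sub, ← mul_pow, ← h1, mul_pow]

theorem etaHat_mul_orthGain_le {N : ℕ} {p : Fin N → ℝ}
    {f : Ω → EuclideanSpace ℂ (Fin S.L)} {w : Ω}
    (hf : IsOCBBeamformer (X.sHat w) (channelShape (X.hs w)) (X.etaHat p w) (f w)) :
    X.etaHat p w * X.orthGain w ≤ S.noise * X.snrS f w := by
  have h := mul_le_mul_of_nonneg_left (hf.le_norm_inner_sq (X.norm_sHat w))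
    (show 0 ≤ X.gs w by unfold gs; positivity)
  rw [snrS, ← X.gs_mul_sub w]
  have := S.noise_pos
  calc _ = _ := by ring
    _ ≤ _ := h
    _ = _ := by field_simp

/-- Given the primary channel, the cross channel and its quantization, the quantized direction is a
fixed unit vector independent of `h_s`. The conditional law is thus the same Erlang law in every
case, which is independence. -/
theorem map_orthGain_prod [IsProbabilityMeasure μ] {n : ℕ} (hn : S.L = n + 2) :
    μ.map (fun w => ((X.hp w, X.hx w, X.sHat w), X.orthGain w)) =
      (μ.map fun w => (X.hp w, X.hx w, X.sHat w)).prod (erlang n) := by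
  have m1 := X.measurable_hp
  have m2 := X.measurable_hx
  have m3 := X.measurable_sHat
  have m4 := X.measurable_hs
  set W : Ω → ℂ × EuclideanSpace ℂ (Fin S.L) × EuclideanSpace ℂ (Fin S.L) :=
    fun w => (X.hp w, X.hx w, X.sHat w) with hW
  have mW : Measurable W := by fun_prop
  have := Measure.isProbabilityMeasure_map (μ := μ) mW.aemeasurable
  have hlaw : μ.map (fun w => (W w, X.hs w)) = (μ.map W).prod (complexNormalVector 1 S.L) := by
    rw [← map_eq_complexNormalVector m4 X.law_hs]
    exact (indepFun_iff_map_prod_eq_prod_map_map mW.aemeasurable m4.aemeasurable).1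
      X.indep_secondary
  have : SFinite (erlang n) := by unfold erlang; infer_instance
  refine Measure.ext_of_lintegral _ fun F hF => ?_
  have h1 : ∫⁻ q, F q ∂μ.map (fun w => (W w, X.orthGain w)) =
      ∫⁻ q, F (q.1, ‖q.2‖ ^ 2 - ‖inner ℂ q.1.2.2 q.2‖ ^ 2) ∂μ.map (fun w => (W w, X.hs w)) := by
    rw [lintegral_map hF (by fun_prop), lintegral_map (by fun_prop) (by fun_prop)]
    rfl
  rw [h1, hlaw, lintegral_prod _ (by fun_prop), lintegral_prod _ hF.aemeasurable,
    lintegral_map hF.lintegral_prod_right' mW, lintegral_map (Measurable.lintegral_prod_right'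
      (f := fun q : (ℂ × EuclideanSpace ℂ (Fin S.L) × EuclideanSpace ℂ (Fin S.L)) ×
        EuclideanSpace ℂ (Fin S.L) => F (q.1, ‖q.2‖ ^ 2 - ‖inner ℂ q.1.2.2 q.2‖ ^ 2))
      (by fun_prop)) mW]
  refine lintegral_congr fun w => ?_
  rw [← map_norm_sq_sub_complexNormalVector_one hn (X.norm_sHat w),
    lintegral_map (by fun_prop) (by fun_prop)]

theorem map_orthGain [IsProbabilityMeasure μ] {n : ℕ} (hn : S.L = n + 2) :
    μ.map X.orthGain = erlang n := by
  have m1 := X.measurable_hp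
  have m2 := X.measurable_hx
  have m3 := X.measurable_sHat
  have h := congrArg (Measure.map Prod.snd) (X.map_orthGain_prod hn)
  have := Measure.isProbabilityMeasure_map (μ := μ)
    (f := fun w => (X.hp w, X.hx w, X.sHat w)) (by fun_prop)
  have : SFinite (erlang n) := by unfold erlang; infer_instance
  rw [Measure.map_map measurable_snd (by fun_prop), Measure.map_snd_prod, measure_univ,
    one_smul] at h
  exact h

theorem indepFun_orthGain [IsProbabilityMeasure μ] :
    IndepFun (fun w => (X.hp w, X.hx w, X.sHat w)) X.orthGain μ := by
  have m1 := X.measurable_hp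
  have m2 := X.measurable_hx
  have m3 := X.measurable_sHat
  obtain ⟨n, hn⟩ := Nat.exists_eq_add_of_le' S.two_le_L
  rw [indepFun_iff_map_prod_eq_prod_map_map (by fun_prop) (by fun_prop), X.map_orthGain hn]
  exact X.map_orthGain_prod hn

/-! ### Cross gain, quantization error and interference margin. -/

@[fun_prop]
theorem measurable_gp : Measurable X.gp := by
  have := X.measurable_hp
  unfold gp
  fun_prop

@[fun_prop]
theorem measurable_gx : Measurable X.gx := by
  have := X.measurable_hx
  unfold gx
  fun_prop

@[fun_prop]
theorem measurable_eps : Measurable X.eps := by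
  have := X.measurable_hx
  have := X.measurable_sHat
  unfold eps
  fun_prop

theorem eps_nonneg (w : Ω) : 0 ≤ X.eps w := by
  have h := norm_inner_le_norm (𝕜 := ℂ) (X.sHat w) (channelShape (X.hx w))
  rw [X.norm_sHat, one_mul] at h
  exact sub_nonneg.2 (pow_le_one₀ (norm_nonneg _) (h.trans (norm_channelShape_le_one _)))

theorem gx_nonneg (w : Ω) : 0 ≤ X.gx w := div_nonneg (by positivity) S.lam_pos.le

theorem margin_nonneg_iff (w : Ω) : 0 ≤ X.margin w ↔ S.thetaP / S.gammaP ≤ X.gp w := by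
  have h1 := S.gammaP_pos
  rw [margin, mul_nonneg_iff_of_pos_left S.noise_pos, sub_nonneg, one_le_div S.thetaP_pos,
    div_le_iff₀ h1, mul_comm]

theorem map_gp : μ.map X.gp = erlang 0 := by
  have := X.measurable_hp
  rw [← map_norm_sq_complexNormal_one, ← X.law_hp, Measure.map_map (by fun_prop) (by fun_prop)]
  rfl

theorem measure_margin_nonneg :
    μ {w | 0 ≤ X.margin w} = ENNReal.ofReal (Real.exp (-(S.thetaP / S.gammaP))) := by
  simp_rw [margin_nonneg_iff]
  rw [← erlang_zero_Ici (div_pos S.thetaP_pos S.gammaP_pos), ← X.map_gp,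
    Measure.map_apply (by fun_prop) measurableSet_Ici]
  rfl

theorem ae_gx_pos : ∀ᵐ w ∂μ, 0 < X.gx w := by
  have h0 : μ {w | X.hx w = 0} = 0 := by
    have h := complexNormalVector_singleton_zero (v := S.lam.toNNReal)
      (by simpa using S.lam_pos) (L := S.L) (by have := S.two_le_L; omega)
    rw [← map_eq_complexNormalVector X.measurable_hx X.law_hx,
      Measure.map_apply X.measurable_hx (measurableSet_singleton 0)] at h
    exact h
  have h1 : ∀ᵐ w ∂μ, X.hx w ≠ 0 := by simpa [ae_iff] using h0
  filter_upwards [h1] with w hw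
  exact div_pos (pow_pos (norm_pos_iff.2 hw) 2) S.lam_pos

/-- The distribution function vanishes at `τ = 0`. With `ae_gx_pos`, this makes the denominator of
`η` positive almost surely, so division by zero plays no role. -/
theorem ae_eps_pos [IsProbabilityMeasure μ] : ∀ᵐ w ∂μ, 0 < X.eps w := by
  have h := X.cdf_le 0 le_rfl (by positivity)
  rw [zero_pow (by have := S.two_le_L; omega), mul_zero, measureReal_eq_zero_iff] at h
  simpa [ae_iff, eps] using h

theorem lintegral_gx : ∫⁻ w, ENNReal.ofReal (X.gx w) ∂μ = S.L := by
  have h := lintegral_norm_sq_complexNormalVector S.lam.toNNReal S.L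
  rw [← map_eq_complexNormalVector X.measurable_hx X.law_hx,
    lintegral_map (by fun_prop) X.measurable_hx] at h
  simp_rw [gx, ENNReal.ofReal_div_of_pos S.lam_pos, div_eq_mul_inv]
  have hm := X.measurable_hx
  rw [lintegral_mul_const _ (by fun_prop), h, mul_assoc]
  have h2 : ((S.lam.toNNReal : NNReal) : ENNReal) = ENNReal.ofReal S.lam := rfl
  rw [h2, ENNReal.mul_inv_cancel (by simpa using S.lam_pos) ENNReal.ofReal_ne_top, mul_one]

theorem lintegral_eps_le [IsProbabilityMeasure μ] :
    ∫⁻ w, ENNReal.ofReal (X.eps w) ∂μ ≤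
      ENNReal.ofReal ((2 : ℝ) ^ (-(B : ℝ) / ((S.L : ℝ) - 1)) * (((S.L : ℝ) - 1) / S.L)) := by
  have hL := S.two_le_L
  have hc : ((S.L - 1 : ℕ) : ℝ) = (S.L : ℝ) - 1 := by rw [Nat.cast_sub (by omega)]; simp
  have hpos : 0 < (S.L : ℝ) - 1 := by
    rw [← hc]
    exact_mod_cast (by omega : 0 < S.L - 1)
  -- Here `K b^m = 1` reads `2^B (2^(-B/(L-1)))^(L-1) = 1`.
  have h := lintegral_le_of_cdf_pow (K := 2 ^ B) (m := S.L - 1)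
    (b := (2 : ℝ) ^ (-(B : ℝ) / ((S.L : ℝ) - 1))) X.measurable_eps X.eps_nonneg (by positivity)
    (by
      rw [← Real.rpow_natCast (_ ^ _), hc, ← Real.rpow_mul (by norm_num),
        div_mul_cancel₀ _ hpos.ne', Real.rpow_neg (by norm_num), Real.rpow_natCast]
      exact mul_inv_cancel₀ (by positivity))
    X.cdf_le X.cdf_gt
  rwa [hc, sub_add_cancel] at h

/-- The quantizer sees only the shape, so gain and error are independent; the mean `L` of the gain
cancels the denominator in the mean error `2^(-B/(L-1)) (L-1)/L`. -/
theorem lintegral_gx_mul_eps_le [IsProbabilityMeasure μ] :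
    ∫⁻ w, ENNReal.ofReal (X.gx w * X.eps w) ∂μ ≤
      ENNReal.ofReal (((S.L : ℝ) - 1) * (2 : ℝ) ^ (-(B : ℝ) / ((S.L : ℝ) - 1))) := by
  have hL := S.two_le_L
  have hind : IndepFun X.gx X.eps μ :=
    X.indep_gain.comp (φ := fun r : ℝ => r ^ 2 / S.lam)
      (ψ := fun q : EuclideanSpace ℂ (Fin S.L) × EuclideanSpace ℂ (Fin S.L) =>
        1 - ‖inner ℂ q.2 q.1‖ ^ 2) (by fun_prop) (by fun_prop)
  have hind2 : IndepFun (fun w => ENNReal.ofReal (X.gx w)) (fun w => ENNReal.ofReal (X.eps w)) μ :=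
    hind.comp ENNReal.measurable_ofReal ENNReal.measurable_ofReal
  simp_rw [ENNReal.ofReal_mul (X.gx_nonneg _)]
  refine (lintegral_mul_eq_lintegral_mul_lintegral_of_indepFun (by fun_prop) (by fun_prop)
    hind2).trans_le ?_
  rw [X.lintegral_gx]
  refine (mul_le_mul_right X.lintegral_eps_le _).trans_eq ?_
  have hLp : (0 : ℝ) < S.L := by exact_mod_cast (by omega : 0 < S.L)
  rw [← ENNReal.ofReal_natCast, ← ENNReal.ofReal_mul hLp.le]
  congr 1
  field_simp

theorem indepFun_margin_eta_orthGain [IsProbabilityMeasure μ] :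
    IndepFun (fun w => (X.margin w, X.eta w)) X.orthGain μ := by
  have hm : Measurable fun q : ℂ × EuclideanSpace ℂ (Fin S.L) × EuclideanSpace ℂ (Fin S.L) =>
      S.noise * (S.gammaP * ‖q.1‖ ^ 2 / S.thetaP - 1) := by fun_prop
  have he : Measurable fun q : ℂ × EuclideanSpace ℂ (Fin S.L) × EuclideanSpace ℂ (Fin S.L) =>
      open Classical in
      if 0 ≤ S.noise * (S.gammaP * ‖q.1‖ ^ 2 / S.thetaP - 1) then
        S.noise * (S.gammaP * ‖q.1‖ ^ 2 / S.thetaP - 1) /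
          (S.lam * (‖q.2.1‖ ^ 2 / S.lam) *
            (1 - ‖inner ℂ q.2.2 (channelShape q.2.1)‖ ^ 2))
      else S.Pmax :=
    Measurable.ite (measurableSet_le measurable_const hm) (by fun_prop) measurable_const
  exact X.indepFun_orthGain.comp (hm.prodMk he) measurable_id

/-! ### The loss from quantizing the channel direction. -/

/-- The event that the interference constraint is active and drives the secondary link, which
could operate at full power, into outage. -/
theorem measure_eta_outage_le [IsProbabilityMeasure μ] :
    μ {w | S.thetaS / S.gammaMax < X.orthGain w ∧ 0 ≤ X.margin w ∧
        X.eta w * X.orthGain w ≤ S.noise * S.thetaS} ≤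
      ENNReal.ofReal (S.phi * (2 : ℝ) ^ (-(B : ℝ) / ((S.L : ℝ) - 1))) := by
  obtain ⟨n, hn⟩ := Nat.exists_eq_add_of_le' S.two_le_L
  have hs : (S.L : ℝ) - 1 = n + 1 := by rw [hn]; push_cast; ring
  have hy : 0 < S.thetaS / S.gammaMax := div_pos S.thetaS_pos S.gammaMax_pos
  have hgam := S.gammaP_pos
  have hth := S.thetaP_pos
  have hts := S.thetaS_pos
  have hlam := S.lam_pos
  have hnoise := S.noise_pos
  set a := S.thetaP / S.gammaP with ha
  have ha0 : 0 < a := div_pos hth hgam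
  have hUV : IndepFun X.gp (fun w => X.gx w * X.eps w) μ :=
    X.indep_primary.comp (φ := fun z : ℂ => ‖z‖ ^ 2)
      (ψ := fun q : EuclideanSpace ℂ (Fin S.L) × EuclideanSpace ℂ (Fin S.L) =>
        ‖q.1‖ ^ 2 / S.lam * (1 - ‖inner ℂ q.2 (channelShape q.1)‖ ^ 2)) (by fun_prop) (by fun_prop)
  have hUVY : IndepFun (fun w => (X.gp w, X.gx w * X.eps w)) X.orthGain μ :=
    X.indepFun_orthGain.comp
      (φ := fun q : ℂ × EuclideanSpace ℂ (Fin S.L) × EuclideanSpace ℂ (Fin S.L) =>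
        (‖q.1‖ ^ 2, ‖q.2.1‖ ^ 2 / S.lam * (1 - ‖inner ℂ q.2.2 (channelShape q.2.1)‖ ^ 2)))
      (by fun_prop) measurable_id
  have key := measure_exponential_mem_Icc_le (a := a) (k := a * S.thetaS * S.lam) X.measurable_gp
    (V := fun w => X.gx w * X.eps w) (by fun_prop) X.measurable_orthGain X.map_gp hUV hUVY
    (by positivity) hy
  refine (measure_mono_ae ?_).trans (key.trans ?_)
  · filter_upwards [X.ae_gx_pos, X.ae_eps_pos] with w hg he
    rintro ⟨h1, h2, h3⟩
    refine ⟨h1, (X.margin_nonneg_iff w).1 h2, ?_⟩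
    have hY : 0 < X.orthGain w := hy.trans h1
    rw [eta, if_pos h2, div_mul_eq_mul_div, div_le_iff₀ (by positivity), margin, mul_assoc,
      mul_assoc, mul_le_mul_iff_right₀ hnoise] at h3
    -- Since `ω = σ² (g_p / a - 1)`, cancelling `σ²` turns `η Y ≤ σ² θ_s` into an upper bound on
    -- `g_p`, and `ω ≥ 0` is the lower bound `g_p ≥ a`.
    have h4 : X.gp w / a - 1 ≤ S.thetaS * (S.lam * X.gx w * X.eps w) / X.orthGain w := by
      rw [le_div_iff₀ hY]
      refine le_trans (le_of_eq ?_) h3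
      rw [ha]
      field_simp
    have h5 := mul_le_mul_of_nonneg_left h4 ha0.le
    have h6 : a * (X.gp w / a - 1) = X.gp w - a := by field_simp
    have h7 : a * (S.thetaS * (S.lam * X.gx w * X.eps w) / X.orthGain w) =
        a * S.thetaS * S.lam * (X.gx w * X.eps w) / X.orthGain w := by ring
    linarith
  · rw [X.map_orthGain hn, lintegral_Ioi_inv_erlang hs hy]
    refine (mul_le_mul_left (mul_le_mul_right X.lintegral_gx_mul_eps_le _) _).trans_eq ?_
    have hL1 : 0 ≤ (S.L : ℝ) - 1 := by rw [hs]; positivity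
    rw [← ENNReal.ofReal_mul (by positivity), ← ENNReal.ofReal_mul (by positivity)]
    congr 1
    have h2 : (S.L : ℝ) - 1 - 1 = S.L - 2 := by ring
    rw [SystemParams.phi, h2, ha]
    field_simp

end ChannelModel

theorem upperGamma_nonneg (s : ℝ) {x : ℝ} (hx : 0 ≤ x) : 0 ≤ upperGamma s x :=
  setIntegral_nonneg measurableSet_Ioi fun t ht => by
    have ht0 : 0 < t := lt_of_le_of_lt hx ht
    positivity

namespace SystemParams

variable (S : SystemParams)

theorem one_le_L_sub_one : (1 : ℝ) ≤ (S.L : ℝ) - 1 := by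
  have : (2 : ℝ) ≤ S.L := by exact_mod_cast S.two_le_L
  linarith

theorem phi_nonneg : 0 ≤ S.phi := by
  have h1 := S.one_le_L_sub_one
  have h2 := upperGamma_nonneg ((S.L : ℝ) - 2) (div_pos S.thetaS_pos S.gammaMax_pos).le
  have h3 := Real.Gamma_pos_of_pos (lt_of_lt_of_le one_pos h1)
  have h4 := S.gammaP_pos
  have h5 := S.lam_pos
  have h6 := S.thetaP_pos
  have h7 := S.thetaS_pos
  have h8 : 0 ≤ (S.L : ℝ) - 1 := by linarith
  unfold phi
  positivity

theorem alpha_nonneg : 0 ≤ S.alpha := by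
  have h2 := upperGamma_nonneg ((S.L : ℝ) - 1) (div_pos S.thetaS_pos S.gammaMax_pos).le
  have h3 := Real.Gamma_pos_of_pos (lt_of_lt_of_le one_pos S.one_le_L_sub_one)
  unfold alpha
  positivity

end SystemParams

/-! ### The loss from quantizing the control signal. -/

namespace ChannelModel

variable {S : SystemParams} {B : ℕ} {Ω : Type*} [MeasurableSpace Ω] {μ : Measure Ω}
  (X : ChannelModel S B μ)

/-- The event that the interference constraint is active and the unquantized control signal lies in
the `n`-th quantization cell. -/
def cell {A : ℕ} (p : Fin (2 ^ A) → ℝ) (n : Fin (2 ^ A)) : Set (ℝ × ℝ) :=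
  {q | 0 ≤ q.1 ∧ p n < q.2 ∧ ∀ h : (n : ℕ) + 1 < 2 ^ A, q.2 ≤ p ⟨n + 1, h⟩}

theorem measurableSet_cell {A : ℕ} (p : Fin (2 ^ A) → ℝ) (n : Fin (2 ^ A)) :
    MeasurableSet (cell p n) := by
  have h : MeasurableSet {q : ℝ × ℝ | ∀ h : (n : ℕ) + 1 < 2 ^ A, q.2 ≤ p ⟨n + 1, h⟩} := by
    rw [Set.ofPred_forall]
    exact MeasurableSet.iInter fun h => measurableSet_le measurable_snd measurable_const
  exact (measurableSet_le measurable_const measurable_fst).inter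
    ((measurableSet_lt measurable_const measurable_snd).inter h)

variable {X} in
-- The conditioning event is `ω ≥ 0`, of probability `e^(-θ_p/γ_p)`; multiplying the conditional
-- probability `2^(-A)` by it removes the conditioning. The last cell has no upper end.
theorem IsIPCCodebook.measure_cell [IsProbabilityMeasure μ] {A : ℕ} {p : Fin (2 ^ A) → ℝ}
    (hp : X.IsIPCCodebook p) (n : Fin (2 ^ A)) :
    μ {w | (X.margin w, X.eta w) ∈ cell p n} =
      ENNReal.ofReal (Real.exp (-(S.thetaP / S.gammaP)) * (2 : ℝ) ^ (-(A : ℝ))) := by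
  have hG : {w | S.thetaP ≤ S.gammaP * X.gp w} = {w | 0 ≤ X.margin w} := by
    ext w
    rw [Set.mem_ofPred_eq, Set.mem_ofPred_eq, X.margin_nonneg_iff, div_le_iff₀ S.gammaP_pos,
      mul_comm]
  have hGm : MeasurableSet {w | S.thetaP ≤ S.gammaP * X.gp w} :=
    measurableSet_le measurable_const (by fun_prop)
  have hGμ : μ {w | S.thetaP ≤ S.gammaP * X.gp w} =
      ENNReal.ofReal (Real.exp (-(S.thetaP / S.gammaP))) := by
    rw [hG, X.measure_margin_nonneg]
  have hcond : ∀ s : Set Ω, (μ[|{w | S.thetaP ≤ S.gammaP * X.gp w}]).real s = 1 / 2 ^ A →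
      μ ({w | 0 ≤ X.margin w} ∩ s) =
        ENNReal.ofReal (Real.exp (-(S.thetaP / S.gammaP)) * (2 : ℝ) ^ (-(A : ℝ))) := by
    intro s hs
    rw [Measure.real, cond_apply hGm, hGμ, hG, ENNReal.toReal_mul, ENNReal.toReal_inv,
      ENNReal.toReal_ofReal (Real.exp_pos _).le] at hs
    rw [← ENNReal.ofReal_toReal (measure_ne_top μ ({w | 0 ≤ X.margin w} ∩ s)),
      Real.rpow_neg (by norm_num), Real.rpow_natCast, ← one_div, ← hs,
      mul_inv_cancel_left₀ (Real.exp_pos _).ne']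
  by_cases h : (n : ℕ) + 1 < 2 ^ A
  · rw [← hcond _ (hp.step n h)]
    congr 1
    ext w
    simp [cell, h]
  · have hn : n = ⟨2 ^ A - 1, Nat.sub_one_lt_of_lt (Nat.two_pow_pos A)⟩ :=
      Fin.ext (by have := n.2; simp only; omega)
    rw [← hcond _ hp.last, ← hn]
    congr 1
    ext w
    simp [cell, h]

/-- The secondary gains at which quantizing the control signal to the lower end of the `n`-th cell
may cause an outage. -/
def lossSet {A : ℕ} (p : Fin (2 ^ A) → ℝ) (c y : ℝ) (n : Fin (2 ^ A)) : Set ℝ :=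
  {t | y < t ∧ p n * t ≤ c ∧ ∀ h : (n : ℕ) + 1 < 2 ^ A, c < p ⟨n + 1, h⟩ * t}

theorem measurableSet_lossSet {A : ℕ} (p : Fin (2 ^ A) → ℝ) (c y : ℝ) (n : Fin (2 ^ A)) :
    MeasurableSet (lossSet p c y n) := by
  have h : MeasurableSet {t : ℝ | ∀ h : (n : ℕ) + 1 < 2 ^ A, c < p ⟨n + 1, h⟩ * t} := by
    rw [Set.ofPred_forall]
    exact MeasurableSet.iInter fun h => measurableSet_lt measurable_const (by fun_prop)
  exact (measurableSet_lt measurable_const measurable_id).inter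
    ((measurableSet_le (by fun_prop : Measurable fun t : ℝ => p n * t) measurable_const).inter h)

/-- For `t > 0` the products `p_n t` increase with `n`, so `c` falls in at most one of the intervals
`[p_n t, p_(n+1) t)`. -/
theorem pairwise_disjoint_lossSet {A : ℕ} {p : Fin (2 ^ A) → ℝ} (hp : StrictMono p) (c : ℝ)
    {y : ℝ} (hy : 0 ≤ y) : Pairwise (Function.onFun Disjoint (lossSet p c y)) := by
  have key : ∀ m n : Fin (2 ^ A), m < n → Disjoint (lossSet p c y m) (lossSet p c y n) := by
    intro m n hmn
    refine Set.disjoint_left.2 fun t hm hn => ?_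
    have h : (m : ℕ) + 1 < 2 ^ A := lt_of_le_of_lt hmn n.2
    have h1 := hm.2.2 h
    have h2 : p ⟨m + 1, h⟩ ≤ p n := hp.monotone hmn
    have h3 := mul_le_mul_of_nonneg_right h2 (hy.trans hm.1.le)
    exact absurd (h1.trans_le h3) (not_lt.2 hn.2.1)
  intro m n hmn
  rcases lt_or_gt_of_ne hmn with h | h
  · exact key m n h
  · exact (key n m h).symm

variable {X} in
-- Independence gives each index the same cell probability times the Erlang measure of its loss set.
-- The loss sets are disjoint inside `Y > y`, so their measures add up to at most one tail and the
-- number of cells does not enter.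
theorem IsIPCCodebook.measure_loss_le [IsProbabilityMeasure μ] {A : ℕ} {p : Fin (2 ^ A) → ℝ}
    (hp : X.IsIPCCodebook p) (c : ℝ) :
    μ (⋃ n, {w | (X.margin w, X.eta w) ∈ cell p n ∧
        X.orthGain w ∈ lossSet p c (S.thetaS / S.gammaMax) n}) ≤
      ENNReal.ofReal (S.alpha * (2 : ℝ) ^ (-(A : ℝ))) := by
  obtain ⟨n, hn⟩ := Nat.exists_eq_add_of_le' S.two_le_L
  have hs : (S.L : ℝ) - 1 = n + 1 := by rw [hn]; push_cast; ring
  have hy : 0 < S.thetaS / S.gammaMax := div_pos S.thetaS_pos S.gammaMax_pos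
  refine (measure_iUnion_le _).trans ?_
  have h1 : ∀ i, μ {w | (X.margin w, X.eta w) ∈ cell p i ∧
      X.orthGain w ∈ lossSet p c (S.thetaS / S.gammaMax) i} =
      ENNReal.ofReal (Real.exp (-(S.thetaP / S.gammaP)) * (2 : ℝ) ^ (-(A : ℝ))) *
        erlang n (lossSet p c (S.thetaS / S.gammaMax) i) := fun i => by
    rw [← hp.measure_cell i, ← X.map_orthGain hn,
      Measure.map_apply X.measurable_orthGain (measurableSet_lossSet _ _ _ _)]
    exact X.indepFun_margin_eta_orthGain.measure_inter_preimage_eq_mul _ _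
      (measurableSet_cell p i) (measurableSet_lossSet _ _ _ _)
  simp_rw [h1]
  rw [ENNReal.tsum_mul_left, ← measure_iUnion (pairwise_disjoint_lossSet hp.strictMono c hy.le)
    fun i => measurableSet_lossSet _ _ _ _]
  calc _ ≤ ENNReal.ofReal (Real.exp (-(S.thetaP / S.gammaP)) * (2 : ℝ) ^ (-(A : ℝ))) *
        erlang n (Set.Ioi (S.thetaS / S.gammaMax)) := by
        gcongr
        exact Set.iUnion_subset fun i t ht => ht.1
    _ = _ := by
        rw [erlang_Ioi hs hy, ← ENNReal.ofReal_mul (by positivity), SystemParams.alpha]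
        congr 1
        ring

/-! ### Assembling the outage bound. -/

theorem measureReal_orthGain_le [IsProbabilityMeasure μ] :
    μ.real {w | X.orthGain w ≤ S.thetaS / S.gammaMax} =
      1 - upperGamma ((S.L : ℝ) - 1) (S.thetaS / S.gammaMax) / Real.Gamma ((S.L : ℝ) - 1) := by
  obtain ⟨n, hn⟩ := Nat.exists_eq_add_of_le' S.two_le_L
  have hs : (S.L : ℝ) - 1 = n + 1 := by rw [hn]; push_cast; ring
  have hy : 0 < S.thetaS / S.gammaMax := div_pos S.thetaS_pos S.gammaMax_pos
  have h1 : {w | X.orthGain w ≤ S.thetaS / S.gammaMax} =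
      (X.orthGain ⁻¹' Set.Ioi (S.thetaS / S.gammaMax))ᶜ := by
    ext w
    simp
  have h3 := Real.Gamma_pos_of_pos (lt_of_lt_of_le one_pos S.one_le_L_sub_one)
  rw [h1, probReal_compl_eq_one_sub (X.measurable_orthGain measurableSet_Ioi), Measure.real,
    ← Measure.map_apply X.measurable_orthGain measurableSet_Ioi, X.map_orthGain hn,
    erlang_Ioi hs hy,
    ENNReal.toReal_ofReal (div_nonneg (upperGamma_nonneg _ hy.le) h3.le)]

variable {X} in
theorem IsIPCCodebook.outage_subset {A : ℕ} {p : Fin (2 ^ A) → ℝ} (hp : X.IsIPCCodebook p)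
    {f : Ω → EuclideanSpace ℂ (Fin S.L)}
    (hf : ∀ w, IsOCBBeamformer (X.sHat w) (channelShape (X.hs w)) (X.etaHat p w) (f w)) :
    {w | X.snrS f w ≤ S.thetaS} ⊆ {w | X.orthGain w ≤ S.thetaS / S.gammaMax} ∪
      ({w | S.thetaS / S.gammaMax < X.orthGain w ∧ 0 ≤ X.margin w ∧
        X.eta w * X.orthGain w ≤ S.noise * S.thetaS} ∪
      ⋃ n, {w | (X.margin w, X.eta w) ∈ cell p n ∧
        X.orthGain w ∈ lossSet p (S.noise * S.thetaS) (S.thetaS / S.gammaMax) n}) := by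
  intro w hw
  have hnoise := S.noise_pos
  have hPmax := S.Pmax_pos
  have hw1 : X.etaHat p w * X.orthGain w ≤ S.noise * S.thetaS :=
    (X.etaHat_mul_orthGain_le (hf w)).trans (mul_le_mul_of_nonneg_left hw hnoise.le)
  have hY := X.orthGain_nonneg w
  by_cases h1 : X.orthGain w ≤ S.thetaS / S.gammaMax
  · exact Or.inl h1
  refine Or.inr ?_
  have h1' := not_le.1 h1
  by_cases h2 : 0 ≤ X.margin w ∧ X.eta w < S.Pmax
  swap
  -- Here `η̂ = P_max`, and an outage at full power would force `Y ≤ θ_s / γ_max`.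
  · rw [etaHat, if_neg h2] at hw1
    refine absurd ?_ h1
    rw [SystemParams.gammaMax, div_div_eq_mul_div, le_div_iff₀ hPmax]
    linarith
  rw [etaHat, if_pos h2] at hw1
  by_cases h3 : X.eta w * X.orthGain w ≤ S.noise * S.thetaS
  · exact Or.inl ⟨h1', h2.1, h3⟩
  refine Or.inr ?_
  have h3' := not_le.1 h3
  have hc : 0 < S.noise * S.thetaS := mul_pos hnoise S.thetaS_pos
  have heta : 0 < X.eta w := by
    by_contra! hneg
    have := mul_nonpos_of_nonpos_of_nonneg hneg hY
    linarith
  -- The index of the largest codeword strictly below `η`; it exists because `p_0 = 0 < η`. If `η`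
  -- is itself a codeword, its floor exceeds `p_n`, but only `p_n ≤ ⌊η⌋` is needed.
  obtain ⟨n, hn, hmax⟩ := Finset.exists_max_image (Finset.univ.filter fun i => p i < X.eta w) id
    ⟨⟨0, Nat.two_pow_pos A⟩, Finset.mem_filter.2
      ⟨Finset.mem_univ _, hp.zero.trans_lt heta⟩⟩
  have hn : p n < X.eta w := by simpa using hn
  have hle : ∀ h : (n : ℕ) + 1 < 2 ^ A, X.eta w ≤ p ⟨n + 1, h⟩ := by
    intro h
    by_contra! hlt
    have h4 := hmax ⟨n + 1, h⟩ (by simpa using hlt)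
    have h5 : (n : ℕ) + 1 ≤ n := h4
    omega
  have hfl : p n ≤ codebookFloor p (X.eta w) :=
    le_csSup ⟨X.eta w, fun q hq => hq.2⟩ ⟨⟨n, rfl⟩, hn.le⟩
  exact Set.mem_iUnion.2 ⟨n, ⟨h2.1, hn, hle⟩, h1',
    (mul_le_mul_of_nonneg_right hfl hY).trans hw1,
    fun h => h3'.trans_le (mul_le_mul_of_nonneg_right (hle h) hY)⟩

variable {X} in
/-- The outage probability bound, without any second-order term. -/
theorem IsIPCCodebook.outage_le [IsProbabilityMeasure μ] {A : ℕ} {p : Fin (2 ^ A) → ℝ}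
    (hp : X.IsIPCCodebook p) {f : Ω → EuclideanSpace ℂ (Fin S.L)}
    (hf : ∀ w, IsOCBBeamformer (X.sHat w) (channelShape (X.hs w)) (X.etaHat p w) (f w)) :
    X.outage f ≤
      1 - upperGamma ((S.L : ℝ) - 1) (S.thetaS / S.gammaMax) / Real.Gamma ((S.L : ℝ) - 1)
        + S.phi * (2 : ℝ) ^ (-(B : ℝ) / ((S.L : ℝ) - 1)) + S.alpha * (2 : ℝ) ^ (-(A : ℝ)) := by
  have h2 := ENNReal.toReal_le_of_le_ofReal
    (mul_nonneg S.phi_nonneg (by positivity)) X.measure_eta_outage_le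
  have h3 := ENNReal.toReal_le_of_le_ofReal
    (mul_nonneg S.alpha_nonneg (by positivity)) (hp.measure_loss_le (S.noise * S.thetaS))
  have h4 := (measureReal_mono (μ := μ) (hp.outage_subset hf)).trans
    ((measureReal_union_le _ _).trans (add_le_add_right (measureReal_union_le _ _) _))
  rw [X.measureReal_orthGain_le] at h4
  simp only [Measure.real] at h4
  unfold outage
  simp only [Measure.real]
  linarith

end ChannelModel

/-- The constant `C` of the error term depends on the system parameters only: not on the numbers of
bits `A` and `B`, nor on the realization of the random model. -/
theorem mainTheorem4 (S : SystemParams) :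
    ∃ C : ℝ, ∀ (A B : ℕ) (Ω : Type u) [MeasurableSpace Ω] (μ : Measure Ω) [IsProbabilityMeasure μ]
      (X : ChannelModel S B μ) (p : Fin (2 ^ A) → ℝ) (f : Ω → EuclideanSpace ℂ (Fin S.L)),
      X.IsIPCCodebook p →
      (∀ w, IsOCBBeamformer (X.sHat w) (channelShape (X.hs w)) (X.etaHat p w) (f w)) →
      X.outage f ≤
        1 - upperGamma ((S.L : ℝ) - 1) (S.thetaS / S.gammaMax) / Real.Gamma ((S.L : ℝ) - 1)
          + S.phi * (2 : ℝ) ^ (-(B : ℝ) / ((S.L : ℝ) - 1))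
          + S.alpha * (2 : ℝ) ^ (-(A : ℝ))
          + C * (2 : ℝ) ^ (-(2 * (B : ℝ)) / ((S.L : ℝ) - 1)) := by
  -- The bound holds without the second-order term, so the constant is zero.
  refine ⟨0, fun A B Ω _ μ _ X p f hp hf => ?_⟩
  rw [zero_mul, add_zero]
  exact hp.outage_le hf
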